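/- Let $d \ge 1$ be an integer, $\tau \in (2,3)$ and $\lambda > 0$. For real $n > 0$, let $G$ be the threshold geometric inhomogeneous random graph on the torus $\mathbb T^d$, defined as follows. The vertices are the points of a homogeneous Poisson point process on $[0,1]^d$ with $n$ points in expectation; that is, their number has the Poisson distribution with mean $n$ and, given their number, their positions are independent and uniform on $[0,1]^d$. Each vertex $v$ independently receives a weight $w_v$ with the Pareto distribution $\Pr[w_v \le w] = 1 - w^{-(\tau-1)}$ for $w \ge 1$. Two distinct vertices $u, v$ with positions $x, y$ are adjacent if and only if $$\max_{1 \le i \le d} \min\{|x_i - y_i|,\ 1 - |x_i - y_i|\} \le \left(\frac{\lambda w_u w_v}{n}\right)^{1/d}.$$ Then $G$ has a connected component of size $\Theta(n)$ with probability $1 - \exp\left(-\Omega(n^{(3-\tau)/2})\right)$. That is, there are constants $a, b, c > 0$ and $n_0$, depending only on $d$, $\tau$ and $\lambda$, such that for all $n \ge n_0$, $$\Pr\left[\, G \text{ has a connected component } C \text{ with } a n \le |C| \le b n \,\right] \ge 1 - \exp\left(-c\, n^{(3-\tau)/2}\right).$$ -/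

import Mathlib

open MeasureTheory ProbabilityTheory
open scoped NNReal

noncomputable section

/-- The distance on the torus: the maximum over the coordinates of
`min {|xᵢ - yᵢ|, 1 - |xᵢ - yᵢ|}`, for points given by coordinates in `[0, 1]`. -/
def torusDist {d : ℕ} (x y : Fin d → unitInterval) : ℝ :=
  ⨆ i : Fin d, min |(x i : ℝ) - (y i : ℝ)| (1 - |(x i : ℝ) - (y i : ℝ)|)

/-- A finite sample of a marked point process: a number `m` of vertices and, for every vertex, its
position (with coordinates in `[0, 1]`) and its weight. -/
abbrev MarkedSample (d : ℕ) : Type :=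
  Σ m : ℕ, Fin m → (Fin d → unitInterval) × ℝ

namespace MarkedSample

variable {d : ℕ}

/-- The position of a vertex. -/
def pos (ω : MarkedSample d) (v : Fin ω.1) : Fin d → unitInterval := (ω.2 v).1

/-- The weight of a vertex. -/
def weight (ω : MarkedSample d) (v : Fin ω.1) : ℝ := (ω.2 v).2

end MarkedSample

/-- The law of a single vertex: a uniform position and, independently, a weight with the Pareto
distribution `P(w ≤ x) = 1 - x ^ (-(τ - 1))` for `x ≥ 1`. -/
def vertexLaw (d : ℕ) (τ : ℝ) : Measure ((Fin d → unitInterval) × ℝ) :=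
  (volume : Measure (Fin d → unitInterval)).prod (paretoMeasure 1 (τ - 1))

/-- The law of the marked homogeneous Poisson point process with `n` expected points: the number of
points has the Poisson distribution with mean `n` and, given this number, the points are independent
with law `vertexLaw d τ`. -/
def markedPoissonLaw (d : ℕ) (τ : ℝ) (n : ℝ≥0) : Measure (MarkedSample d) :=
  (poissonMeasure n).bind fun m =>
    (Measure.pi fun _ : Fin m => vertexLaw d τ).map (Sigma.mk m)

/-- The threshold graph on the torus of a sample: distinct vertices `u`, `v` are adjacent if and
only if their torus distance is at most `(lam * w_u * w_v / n) ^ (1 / d)`. Under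
`markedPoissonLaw d τ n` this is the threshold geometric inhomogeneous random graph with ground
space the torus. -/
def torusGIRG {d : ℕ} (lam : ℝ) (n : ℝ≥0) (ω : MarkedSample d) : SimpleGraph (Fin ω.1) where
  Adj u v := u ≠ v ∧
    torusDist (ω.pos u) (ω.pos v) ≤ (lam * ω.weight u * ω.weight v / (n : ℝ)) ^ (1 / (d : ℝ))
  symm := ⟨fun u v h => ⟨h.1.symm, by
    have e : torusDist (ω.pos v) (ω.pos u) = torusDist (ω.pos u) (ω.pos v) := by
      simp only [torusDist, abs_sub_comm]
    rw [e, mul_right_comm]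
    exact h.2⟩⟩
  loopless := ⟨fun _ h => h.1 rfl⟩

end

/-! Split the torus into dyadic cells. A level-`j` cell has mean occupation μ = n / 2^(jd); call its
vertices heavy when their weight is at least about √μ. Heavy vertices of a cell and of its child are
adjacent (`le_mul_of_heavyWeight_le`). A cell has K μ^α heavy vertices in expectation, where α = (3
- τ)/2 > 0 (`mul_heavyWeight_rpow_neg`), so it is void with probability exp(-K μ^α).

Disjoint cells are independent, so the void cells of each level obey a Chernoff bound
(`measureReal_le_card_filter_le`). Their tolerated proportions sum to at most 1/2
(`exists_sum_tolerance_le`), so half of the cells at a last level J with 2^(Jd) of order n have no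
void ancestor. Their heavy vertices are joined through the root cell, which gives a component of
linear size (`exists_component_of_heavy`).

The failure probabilities exp(-c(1 + j)n^α) sum without a logarithmic loss. The upper bound on the
size is the Poisson tail of the number of vertices. -/

/-! ### The marked Poisson process -/

/-- The probability generating function of the Poisson distribution. -/
lemma lintegral_pow_poissonMeasure (r : ℝ≥0) {t : ℝ} (ht : 0 ≤ t) :
    ∫⁻ m, ENNReal.ofReal (t ^ m) ∂(poissonMeasure r) = ENNReal.ofReal (Real.exp (r * (t - 1))) := by
  have hs : HasSum (fun m : ℕ => Real.exp (-r) * r ^ m / (m.factorial : ℝ) * t ^ m)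
      (Real.exp (r * (t - 1))) := by
    have h := (NormedSpace.expSeries_div_hasSum_exp ((r : ℝ) * t)).mul_left (Real.exp (-r))
    rw [← Real.exp_eq_exp_ℝ, ← Real.exp_add] at h
    convert! h using 1
    · ext m
      rw [mul_pow]
      ring
    · congr 1
      ring
  rw [poissonMeasure, lintegral_sum_measure, ← hs.tsum_eq,
    ENNReal.ofReal_tsum_of_nonneg (fun m => by positivity) hs.summable]
  congr 1
  ext m
  rw [lintegral_smul_measure, lintegral_dirac, smul_eq_mul, ← ENNReal.ofReal_mul (by positivity)]

lemma isProbabilityMeasure_vertexLaw (d : ℕ) {τ : ℝ} (hτ : 1 < τ) :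
    IsProbabilityMeasure (vertexLaw d τ) := by
  have := isProbabilityMeasure_paretoMeasure (t := 1) (r := τ - 1) one_pos (by linarith)
  unfold vertexLaw
  infer_instance

lemma markedPoissonLaw_apply (d : ℕ) (τ : ℝ) (n : ℝ≥0) {s : Set (MarkedSample d)}
    (hs : MeasurableSet s) :
    markedPoissonLaw d τ n s = ∫⁻ m, (Measure.pi fun _ : Fin m => vertexLaw d τ)
      ((fun x => (⟨m, x⟩ : MarkedSample d)) ⁻¹' s) ∂(poissonMeasure n) := by
  rw [markedPoissonLaw, Measure.bind_apply hs (measurable_from_top.aemeasurable)]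
  refine lintegral_congr fun m => ?_
  exact Measure.map_apply (f := fun x => (⟨m, x⟩ : MarkedSample d))
    (measurable_iff_le_map.2 (iInf_le _ m)) hs

lemma measurableSet_markedSample {d : ℕ} {s : Set (MarkedSample d)}
    (hs : ∀ m, MeasurableSet ((fun x => (⟨m, x⟩ : MarkedSample d)) ⁻¹' s)) : MeasurableSet s :=
  MeasurableSpace.measurableSet_iInf.2 hs

lemma isProbabilityMeasure_markedPoissonLaw (d : ℕ) {τ : ℝ} (hτ : 1 < τ) (n : ℝ≥0) :
    IsProbabilityMeasure (markedPoissonLaw d τ n) := by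
  have := isProbabilityMeasure_vertexLaw d hτ
  constructor
  rw [markedPoissonLaw_apply _ _ _ MeasurableSet.univ]
  simp

/-- The number of vertices is rarely more than four times its mean. -/
lemma markedPoissonLaw_real_four_mul_lt_card_le (d : ℕ) {τ : ℝ} (hτ : 1 < τ) (n : ℝ≥0) :
    (markedPoissonLaw d τ n).real {ω | 4 * (n : ℝ) < ω.1} ≤ Real.exp (-n) := by
  have := isProbabilityMeasure_vertexLaw d hτ
  have hm : MeasurableSet {ω : MarkedSample d | 4 * (n : ℝ) < ω.1} :=
    measurableSet_markedSample fun m => by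
      by_cases h : 4 * (n : ℝ) < m <;> simp [h]
  refine ENNReal.toReal_le_of_le_ofReal (Real.exp_nonneg _) ?_
  rw [markedPoissonLaw_apply _ _ _ hm]
  have h2 := Real.log_two_gt_d9
  -- Exponential Markov with base 2: 4 log 2 > 2 gives 2^m ≥ e^(2n) on the event, while the mean of
  -- 2^m is e^n.
  calc _ ≤ ∫⁻ m, ENNReal.ofReal (Real.exp (-(2 * n))) * ENNReal.ofReal (2 ^ m)
        ∂(poissonMeasure n) := by
        refine lintegral_mono fun m => ?_
        by_cases h : 4 * (n : ℝ) < m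
        · refine prob_le_one.trans ?_
          rw [← ENNReal.ofReal_mul (Real.exp_nonneg _), ENNReal.one_le_ofReal,
            ← Real.exp_log (show (0 : ℝ) < 2 ^ m by positivity), ← Real.exp_add, Real.log_pow]
          refine Real.one_le_exp ?_
          nlinarith [n.2]
        · simp [h]
    _ = _ := by
        rw [lintegral_const_mul _ measurable_from_top, lintegral_pow_poissonMeasure n zero_le_two,
          ← ENNReal.ofReal_mul (Real.exp_nonneg _), ← Real.exp_add]
        ring_nf

lemma measurableSet_forall_notMem {d : ℕ} {R : Set ((Fin d → unitInterval) × ℝ)}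
    (hR : MeasurableSet R) : MeasurableSet {ω : MarkedSample d | ∀ v, ω.2 v ∉ R} :=
  measurableSet_markedSample fun m => by
    change MeasurableSet {x : Fin m → (Fin d → unitInterval) × ℝ | ∀ v, x v ∉ R}
    rw [Set.ofPred_forall]
    exact MeasurableSet.iInter fun v => hR.compl.preimage (measurable_pi_apply v)

/-- The void probabilities of the marked Poisson process. -/
lemma markedPoissonLaw_real_forall_notMem (d : ℕ) {τ : ℝ} (hτ : 1 < τ) (n : ℝ≥0)
    {R : Set ((Fin d → unitInterval) × ℝ)} (hR : MeasurableSet R) :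
    (markedPoissonLaw d τ n).real {ω | ∀ v, ω.2 v ∉ R} =
      Real.exp (-(n * (vertexLaw d τ).real R)) := by
  have := isProbabilityMeasure_vertexLaw d hτ
  have h (m : ℕ) : (Measure.pi fun _ : Fin m => vertexLaw d τ)
      ((fun x => (⟨m, x⟩ : MarkedSample d)) ⁻¹' {ω : MarkedSample d | ∀ v, ω.2 v ∉ R}) =
        ENNReal.ofReal ((1 - (vertexLaw d τ).real R) ^ m) := by
    have e : (fun x => (⟨m, x⟩ : MarkedSample d)) ⁻¹' {ω : MarkedSample d | ∀ v, ω.2 v ∉ R} =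
        Set.univ.pi fun _ : Fin m => Rᶜ := by
      ext x
      simp
    rw [e, Measure.pi_pi, Finset.prod_const, Finset.card_univ, Fintype.card_fin,
      ← probReal_compl_eq_one_sub hR, ENNReal.ofReal_pow measureReal_nonneg,
      ofReal_measureReal]
  rw [measureReal_def, markedPoissonLaw_apply _ _ _ (measurableSet_forall_notMem hR)]
  simp_rw [h]
  rw [lintegral_pow_poissonMeasure n (sub_nonneg.2 measureReal_le_one),
    ENNReal.toReal_ofReal (Real.exp_nonneg _)]
  ring_nf

/-! ### A Chernoff bound from joint probabilities -/

open scoped Classical in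
/-- A Chernoff bound for the number of events that occur, among events of which any `k` occur
simultaneously with probability at most `p ^ k`. -/
lemma measureReal_le_card_filter_le {Ω ι : Type*} [MeasurableSpace Ω] (P : Measure Ω)
    [IsProbabilityMeasure P] (T : Finset ι) (E : ι → Set Ω)
    (hE : ∀ i ∈ T, MeasurableSet (E i)) {p : ℝ} (hp : 0 ≤ p)
    (h : ∀ S ⊆ T, P.real (⋂ i ∈ S, E i) ≤ p ^ S.card) {s : ℝ} (hs : 0 ≤ s) (x : ℝ) :
    P.real {ω | x ≤ ((T.filter fun i => ω ∈ E i).card : ℝ)} ≤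
      Real.exp (-(s * x) + T.card * (p * Real.exp s)) := by
  have hs1 : 0 ≤ Real.exp s - 1 := sub_nonneg.2 (Real.one_le_exp hs)
  -- Expanding ∏ (1 + (e^s - 1) 1_E) over subsets leaves only probabilities of intersections, so the
  -- hypothesis replaces independence.
  have e (ω : Ω) : Real.exp (s * ((T.filter fun i => ω ∈ E i).card : ℝ)) =
      ∑ S ∈ T.powerset, (⋂ i ∈ S, E i).indicator (fun _ => (Real.exp s - 1) ^ S.card) ω := by
    have h1 : Real.exp (s * ((T.filter fun i => ω ∈ E i).card : ℝ)) =
        ∏ i ∈ T, (1 + (E i).indicator (fun _ => Real.exp s - 1) ω) := by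
      rw [mul_comm, Real.exp_nat_mul, ← Finset.prod_const, Finset.prod_filter]
      refine Finset.prod_congr rfl fun i _ => ?_
      by_cases hi : ω ∈ E i <;> simp [hi]
    rw [h1, Finset.prod_one_add]
    refine Finset.sum_congr rfl fun S _ => ?_
    rw [prod_indicator_const_apply]
    rfl
  have hmeas : ∀ S ∈ T.powerset, MeasurableSet (⋂ i ∈ S, E i) := fun S hS =>
    Finset.measurableSet_biInter S fun i hi => hE i (Finset.mem_powerset.1 hS hi)
  have hint : ∀ S ∈ T.powerset,
      Integrable ((⋂ i ∈ S, E i).indicator fun _ => (Real.exp s - 1) ^ S.card) P := fun S hS =>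
    (integrable_const _).indicator (hmeas S hS)
  have hI : Integrable (fun ω => Real.exp (s * ((T.filter fun i => ω ∈ E i).card : ℝ))) P := by
    simp_rw [e]
    exact integrable_finsetSum _ hint
  refine (measure_ge_le_exp_mul_mgf x hs hI).trans ?_
  rw [Real.exp_add, neg_mul]
  refine mul_le_mul_of_nonneg_left ?_ (Real.exp_nonneg _)
  calc mgf _ P s = ∑ S ∈ T.powerset, P.real (⋂ i ∈ S, E i) * (Real.exp s - 1) ^ S.card := by
        unfold mgf
        simp_rw [e]
        rw [integral_finsetSum _ hint]
        refine Finset.sum_congr rfl fun S hS => ?_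
        rw [integral_indicator_const _ (hmeas S hS), smul_eq_mul]
    _ ≤ ∑ S ∈ T.powerset, (p * (Real.exp s - 1)) ^ S.card := by
        refine Finset.sum_le_sum fun S hS => ?_
        rw [mul_pow]
        exact mul_le_mul_of_nonneg_right (h S (Finset.mem_powerset.1 hS)) (by positivity)
    _ = (1 + p * (Real.exp s - 1)) ^ T.card := by
        rw [← Finset.prod_const, Finset.prod_one_add]
        simp
    _ ≤ (Real.exp (p * Real.exp s)) ^ T.card := by
        refine pow_le_pow_left₀ (by positivity) ?_ _
        have := Real.add_one_le_exp (p * Real.exp s)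
        nlinarith
    _ = _ := (Real.exp_nat_mul _ _).symm

/-! ### Pareto tails and dyadic cells -/

lemma paretoMeasure_real_Ici {r W : ℝ} (hr : 0 < r) (hW : 1 ≤ W) :
    (paretoMeasure 1 r).real (Set.Ici W) = W ^ (-r) := by
  have hW0 : 0 < W := by linarith
  rw [measureReal_def, paretoMeasure, withDensity_apply _ measurableSet_Ici]
  unfold paretoPDF
  rw [← integral_eq_lintegral_of_nonneg_ae
    (ae_of_all _ fun x => paretoPDFReal_nonneg zero_le_one hr.le x)
    (measurable_paretoPDFReal 1 r).aestronglyMeasurable,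
    setIntegral_congr_fun (g := fun x => r * x ^ (-(r + 1))) measurableSet_Ici fun x hx => by
      have hx' : 1 ≤ x := hW.trans hx
      simp [paretoPDFReal, hx'],
    integral_Ici_eq_integral_Ioi, integral_const_mul, integral_Ioi_rpow_of_lt (by linarith) hW0]
  have e : -(r + 1) + 1 = -r := by ring
  rw [e]
  field_simp

/-- The dyadic cell of side length `2 ^ (-j)` with index `q`. -/
def dyadicCell {d : ℕ} (j : ℕ) (q : Fin d → ℕ) : Set (Fin d → unitInterval) :=
  {x | ∀ i, ⌊2 ^ j * (x i : ℝ)⌋₊ = q i}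

lemma dyadicCell_eq_pi {d : ℕ} (j : ℕ) (q : Fin d → ℕ) :
    dyadicCell j q = Set.univ.pi fun i => {t : unitInterval | ⌊2 ^ j * (t : ℝ)⌋₊ = q i} := by
  ext x
  simp [dyadicCell]

lemma measurableSet_floor_eq (j k : ℕ) :
    MeasurableSet {t : unitInterval | ⌊2 ^ j * (t : ℝ)⌋₊ = k} :=
  (Nat.measurable_floor.comp (by fun_prop : Measurable fun t : unitInterval => 2 ^ j * (t : ℝ)))
    (measurableSet_singleton k)

lemma measurableSet_dyadicCell {d : ℕ} (j : ℕ) (q : Fin d → ℕ) :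
    MeasurableSet (dyadicCell j q) := by
  rw [dyadicCell_eq_pi]
  exact MeasurableSet.univ_pi fun i => measurableSet_floor_eq j (q i)

lemma volume_floor_eq {j k : ℕ} (hk : k < 2 ^ j) :
    volume {t : unitInterval | ⌊2 ^ j * (t : ℝ)⌋₊ = k} = ENNReal.ofReal (2 ^ j)⁻¹ := by
  have h2 : (0 : ℝ) < 2 ^ j := by positivity
  have hk' : (k : ℝ) + 1 ≤ 2 ^ j := by exact_mod_cast hk
  have e : Subtype.val '' {t : unitInterval | ⌊2 ^ j * (t : ℝ)⌋₊ = k} =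
      Set.Icc 0 1 ∩ Set.Ico ((k : ℝ) / 2 ^ j) ((k + 1) / 2 ^ j) := by
    ext t
    simp only [Set.mem_image, Set.mem_ofPred_eq, Subtype.exists, exists_and_right, exists_eq_right,
      Set.mem_inter_iff, Set.mem_Ico, div_le_iff₀ h2, lt_div_iff₀ h2]
    constructor
    · rintro ⟨ht, h⟩
      rw [Nat.floor_eq_iff (mul_nonneg h2.le ht.1)] at h
      exact ⟨ht, by linarith [h.1], by linarith [h.2]⟩
    · rintro ⟨ht, h⟩
      refine ⟨ht, ?_⟩
      rw [Nat.floor_eq_iff (mul_nonneg h2.le ht.1)]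
      exact ⟨by linarith [h.1], by linarith [h.2]⟩
  have hI : Set.Ico ((k : ℝ) / 2 ^ j) ((k + 1) / 2 ^ j) ⊆ Set.Icc 0 1 := fun t ht =>
    ⟨le_trans (by positivity) ht.1, ht.2.le.trans ((div_le_one h2).2 hk')⟩
  rw [unitInterval.volume_apply, e, Set.inter_eq_self_of_subset_right hI, Real.volume_Ico]
  congr 1
  field_simp
  ring

lemma volume_real_dyadicCell {d j : ℕ} {q : Fin d → ℕ} (hq : ∀ i, q i < 2 ^ j) :
    (volume : Measure (Fin d → unitInterval)).real (dyadicCell j q) = ((2 ^ j) ^ d)⁻¹ := by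
  rw [measureReal_def, dyadicCell_eq_pi, volume_pi_pi]
  simp_rw [volume_floor_eq (hq _)]
  rw [Finset.prod_const, Finset.card_univ, Fintype.card_fin, ENNReal.toReal_pow,
    ENNReal.toReal_ofReal (by positivity), inv_pow]

lemma disjoint_dyadicCell {d j : ℕ} {q q' : Fin d → ℕ} (h : q ≠ q') :
    Disjoint (dyadicCell j q) (dyadicCell j q') :=
  Set.disjoint_left.2 fun _ hx hx' => h (funext fun i => (hx i).symm.trans (hx' i))

/-- The probability that every one of the given cells is free of vertices of weight at least `W`. -/
lemma markedPoissonLaw_real_iInter_void (d : ℕ) {τ : ℝ} (hτ : 1 < τ) (n : ℝ≥0) {j : ℕ} {W : ℝ}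
    (hW : 1 ≤ W) {S : Finset (Fin d → ℕ)} (hS : ∀ q ∈ S, ∀ i, q i < 2 ^ j) :
    (markedPoissonLaw d τ n).real
        (⋂ q ∈ S, {ω | ∀ v, ω.2 v ∉ dyadicCell j q ×ˢ Set.Ici W}) =
      Real.exp (-(n / (2 ^ j) ^ d * W ^ (-(τ - 1)))) ^ S.card := by
  have := isProbabilityMeasure_vertexLaw d hτ
  have := isProbabilityMeasure_paretoMeasure (t := 1) (r := τ - 1) one_pos (by linarith)
  have hmeas (q : Fin d → ℕ) : MeasurableSet (dyadicCell j q ×ˢ Set.Ici W) :=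
    (measurableSet_dyadicCell j q).prod measurableSet_Ici
  -- Joint voidness is voidness of a disjoint union, whose measure adds up in the exponent.
  have e : (⋂ q ∈ S, {ω : MarkedSample d | ∀ v, ω.2 v ∉ dyadicCell j q ×ˢ Set.Ici W}) =
      {ω | ∀ v, ω.2 v ∉ ⋃ q ∈ S, dyadicCell j q ×ˢ Set.Ici W} := by
    ext ω
    simp only [Set.mem_iInter, Set.mem_ofPred_eq, Set.mem_iUnion, not_exists]
    exact ⟨fun h v q hq => h q hq v, fun h q hq v => h v q hq⟩
  rw [e, markedPoissonLaw_real_forall_notMem d hτ n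
    (Finset.measurableSet_biUnion S fun q _ => hmeas q),
    measureReal_biUnion_finset (fun q _ q' _ h => Set.Disjoint.set_prod_left
      (disjoint_dyadicCell h) _ _) (fun q _ => hmeas q), ← Real.exp_nat_mul]
  have hv : ∀ q ∈ S, (vertexLaw d τ).real (dyadicCell j q ×ˢ Set.Ici W) =
      ((2 ^ j) ^ d)⁻¹ * W ^ (-(τ - 1)) := fun q hq => by
    rw [vertexLaw, measureReal_prod_prod, volume_real_dyadicCell (hS q hq),
      paretoMeasure_real_Ici (by linarith) hW]
  rw [Finset.sum_congr rfl hv, Finset.sum_const, nsmul_eq_mul]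
  congr 1
  ring

lemma dyadicCell_subset_ancestor {d j i : ℕ} {q : Fin d → ℕ} :
    dyadicCell (j + i) q ⊆ dyadicCell j fun k => q k / 2 ^ i := fun x hx k => by
  change _ = q k / 2 ^ i
  rw [← hx k, ← Nat.floor_div_natCast, pow_add]
  congr 1
  push_cast
  field_simp

lemma torusDist_le_of_mem_dyadicCell {d j : ℕ} {q : Fin d → ℕ} {x y : Fin d → unitInterval}
    (hx : x ∈ dyadicCell j q) (hy : y ∈ dyadicCell j q) : torusDist x y ≤ (2 ^ j)⁻¹ := by
  refine Real.iSup_le (fun i => (min_le_left _ _).trans ?_) (by positivity)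
  have h2 : (0 : ℝ) < 2 ^ j := by positivity
  have hx1 := (Nat.floor_eq_iff (mul_nonneg h2.le (x i).2.1)).1 (hx i)
  have hy1 := (Nat.floor_eq_iff (mul_nonneg h2.le (y i).2.1)).1 (hy i)
  rw [← one_div, le_div_iff₀ h2, ← abs_of_pos h2, ← abs_mul, abs_le]
  constructor <;> linarith

/-! ### Heavy vertices and the component they span -/

lemma torusGIRG_reachable_of_mem_dyadicCell {d : ℕ} (hd : 1 ≤ d) {lam : ℝ} {n : ℝ≥0} (hn : 0 < n)
    {ω : MarkedSample d} {u v : Fin ω.1} {j : ℕ} {q : Fin d → ℕ}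
    (hu : (ω.2 u).1 ∈ dyadicCell j q) (hv : (ω.2 v).1 ∈ dyadicCell j q)
    (h : (n : ℝ) / (2 ^ j) ^ d ≤ lam * (ω.2 u).2 * (ω.2 v).2) :
    (torusGIRG lam n ω).Reachable u v := by
  rcases eq_or_ne u v with rfl | huv
  · rfl
  refine SimpleGraph.Adj.reachable ⟨huv, (torusDist_le_of_mem_dyadicCell hu hv).trans ?_⟩
  have hn' : (0 : ℝ) < n := hn
  calc ((2 : ℝ) ^ j)⁻¹ = ((((2 : ℝ) ^ j) ^ d)⁻¹) ^ (1 / (d : ℝ)) := by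
        rw [← inv_pow ((2 : ℝ) ^ j) d, one_div, Real.pow_rpow_inv_natCast (by positivity) (by omega)]
    _ ≤ _ := by
        refine Real.rpow_le_rpow (by positivity) ?_ (by positivity)
        rw [le_div_iff₀ hn']
        simpa [MarkedSample.weight, div_eq_inv_mul] using h

/-- The weight from which on a vertex is heavy for a cell of level `j`: heavy vertices of a cell and
of its parent are adjacent. -/
noncomputable def heavyWeight (d : ℕ) (lam : ℝ) (n : ℝ≥0) (j : ℕ) : ℝ :=
  √(2 ^ d * (n / (2 ^ j) ^ d) / lam)

/-- The factor 2^d in `heavyWeight` cancels the volume ratio of parent and child: the child's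
threshold is √(μ/λ) with μ the parent's mean occupation, and the parent's threshold is no smaller.
-/
lemma le_mul_of_heavyWeight_le {d : ℕ} {lam : ℝ} (hlam : 0 < lam) {n : ℝ≥0} {j : ℕ} {a b : ℝ}
    (ha : heavyWeight d lam n j ≤ a) (hb : heavyWeight d lam n (j + 1) ≤ b) :
    (n : ℝ) / (2 ^ j) ^ d ≤ lam * a * b := by
  have e : (2 : ℝ) ^ d * (n / (2 ^ (j + 1)) ^ d) / lam = n / (2 ^ j) ^ d / lam := by
    rw [pow_succ, mul_pow]
    field_simp
  have ha' : √((n : ℝ) / (2 ^ j) ^ d / lam) ≤ a := by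
    refine le_trans (Real.sqrt_le_sqrt ?_) ha
    gcongr
    exact le_mul_of_one_le_left (by positivity) (one_le_pow₀ one_le_two)
  rw [heavyWeight, e] at hb
  have ha0 : 0 ≤ a := (Real.sqrt_nonneg _).trans ha'
  have hs := Real.mul_self_sqrt (show (0 : ℝ) ≤ n / (2 ^ j) ^ d / lam by positivity)
  calc (n : ℝ) / (2 ^ j) ^ d = lam * (√((n : ℝ) / (2 ^ j) ^ d / lam) *
        √((n : ℝ) / (2 ^ j) ^ d / lam)) := by
        rw [hs]
        field_simp
    _ ≤ lam * (a * b) := by gcongr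
    _ = _ := by ring

lemma le_mul_of_heavyWeight_le_of_le {d : ℕ} {lam : ℝ} (hlam : 0 < lam) {n : ℝ≥0} {j : ℕ}
    {a b : ℝ} (ha : heavyWeight d lam n j ≤ a) (hb : heavyWeight d lam n j ≤ b) :
    (n : ℝ) / (2 ^ j) ^ d ≤ lam * a * b := by
  refine le_mul_of_heavyWeight_le hlam ha (le_trans (Real.sqrt_le_sqrt ?_) hb)
  gcongr
  · exact one_le_two
  · omega

/-- If all ancestors of the given cells of level `J` hold a heavy vertex, then the heavy vertices
of these cells lie in a common component. -/
lemma exists_component_of_heavy {d : ℕ} (hd : 1 ≤ d) {lam : ℝ} (hlam : 0 < lam) {n : ℝ≥0}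
    (hn : 0 < n) {ω : MarkedSample d} {J : ℕ} {L : Finset (Fin d → ℕ)} (hL : L.Nonempty)
    (hlt : ∀ q ∈ L, ∀ i, q i < 2 ^ J)
    (h : ∀ q ∈ L, ∀ j ≤ J, ∃ v, ω.2 v ∈
      dyadicCell j (fun i => q i / 2 ^ (J - j)) ×ˢ Set.Ici (heavyWeight d lam n j)) :
    ∃ C : (torusGIRG lam n ω).ConnectedComponent, L.card ≤ C.supp.ncard := by
  obtain ⟨q₀, hq₀⟩ := hL
  have : Nonempty (Fin ω.1) := ⟨(h q₀ hq₀ 0 (Nat.zero_le _)).choose⟩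
  choose! v hv using h
  have hroot : ∀ q ∈ L, ∀ q' ∈ L, (torusGIRG lam n ω).Reachable (v q 0) (v q' 0) := by
    intro q hq q' hq'
    have h1 := hv q hq 0 (Nat.zero_le _)
    have h2 := hv q' hq' 0 (Nat.zero_le _)
    -- At level 0 every ancestor index is 0, so all chains start in the same cell.
    have e : (fun i => q' i / 2 ^ (J - 0)) = fun i => q i / 2 ^ (J - 0) := by
      ext i
      rw [Nat.sub_zero, Nat.div_eq_of_lt (hlt q hq i), Nat.div_eq_of_lt (hlt q' hq' i)]
    rw [e] at h2
    exact torusGIRG_reachable_of_mem_dyadicCell hd hn h1.1 h2.1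
      (le_mul_of_heavyWeight_le_of_le hlam h1.2 h2.2)
  have hpath : ∀ q ∈ L, ∀ j ≤ J, (torusGIRG lam n ω).Reachable (v q 0) (v q j) := by
    intro q hq j
    induction j with
    | zero => exact fun _ => SimpleGraph.Reachable.refl _
    | succ j ih =>
      intro hj
      refine (ih (by omega)).trans ?_
      have h1 := hv q hq j (by omega)
      have h2 := hv q hq (j + 1) hj
      refine torusGIRG_reachable_of_mem_dyadicCell hd hn h1.1 ?_
        (le_mul_of_heavyWeight_le hlam h1.2 h2.2)
      have h3 := dyadicCell_subset_ancestor h2.1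
      simp only [Nat.div_div_eq_div_mul, ← pow_add] at h3
      rwa [show J - (j + 1) + 1 = J - j by omega] at h3
  refine ⟨(torusGIRG lam n ω).connectedComponentMk (v q₀ 0), ?_⟩
  rw [← Set.ncard_coe_finset L]
  refine Set.ncard_le_ncard_of_injOn (fun q => v q J) (fun q hq => ?_) (fun q hq q' hq' e => ?_)
    (Set.toFinite _)
  · rw [SimpleGraph.ConnectedComponent.mem_supp_iff, SimpleGraph.ConnectedComponent.eq]
    exact ((hroot q₀ hq₀ q hq).trans (hpath q hq J le_rfl)).symm
  · have h1 := (hv q hq J le_rfl).1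
    have h2 := (hv q' hq' J le_rfl).1
    simp only at e
    rw [← e] at h2
    ext i
    have h3 := (h1 i).symm.trans (h2 i)
    simpa using h3

/-! ### Counting cells with bad ancestors -/

/-- The indices of the dyadic cells of level `j`. -/
def cellIndices (d j : ℕ) : Finset (Fin d → ℕ) :=
  Fintype.piFinset fun _ => Finset.range (2 ^ j)

lemma mem_cellIndices {d j : ℕ} {q : Fin d → ℕ} : q ∈ cellIndices d j ↔ ∀ i, q i < 2 ^ j := by
  simp [cellIndices]

lemma card_cellIndices (d j : ℕ) : (cellIndices d j).card = (2 ^ j) ^ d := by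
  simp [cellIndices]

lemma card_filter_ancestor_eq_le {d i J : ℕ} (r : Fin d → ℕ) :
    ((cellIndices d J).filter fun q => (fun k => q k / 2 ^ i) = r).card ≤ (2 ^ i) ^ d := by
  calc _ ≤ (Fintype.piFinset fun k => Finset.Ico (r k * 2 ^ i) (r k * 2 ^ i + 2 ^ i)).card := by
        refine Finset.card_le_card fun q hq => ?_
        rw [Fintype.mem_piFinset]
        intro k
        rw [← congrFun (Finset.mem_filter.1 hq).2 k, Finset.mem_Ico]
        have := Nat.div_add_mod' (q k) (2 ^ i)
        have := Nat.mod_lt (q k) (Nat.two_pow_pos i)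
        constructor <;> omega
    _ = _ := by simp

lemma card_filter_ancestor_mem_le {d i J : ℕ} (B : Finset (Fin d → ℕ)) :
    ((cellIndices d J).filter fun q => (fun k => q k / 2 ^ i) ∈ B).card ≤
      (2 ^ i) ^ d * B.card := by
  refine Finset.card_le_mul_card_image_of_maps_to 
    (f := fun (q : Fin d → ℕ) k => q k / 2 ^ i)
    (fun q hq => (Finset.mem_filter.1 hq).2) _ fun r _ => ?_
  refine (Finset.card_le_card ?_).trans (card_filter_ancestor_eq_le (J := J) r)
  intro q hq
  simp only [Finset.mem_filter] at hq ⊢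
  exact ⟨hq.1.1, hq.2⟩

/-- If few cells of every level are bad, then half of the cells of the last level have no bad
ancestor. -/
lemma half_le_card_filter_ancestor_notMem {d J : ℕ} (B : ℕ → Finset (Fin d → ℕ)) (ε : ℕ → ℝ)
    (hB : ∀ j ≤ J, ((B j).card : ℝ) ≤ ε j * (2 ^ j) ^ d)
    (hε : ∑ j ∈ Finset.range (J + 1), ε j ≤ 1 / 2) :
    ((2 : ℝ) ^ J) ^ d / 2 ≤ (((cellIndices d J).filter fun q =>
      ∀ j ≤ J, (fun k => q k / 2 ^ (J - j)) ∉ B j).card : ℝ) := by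
  have hsub : (cellIndices d J).filter (fun q =>
      ¬ ∀ j ≤ J, (fun k => q k / 2 ^ (J - j)) ∉ B j) ⊆ (Finset.range (J + 1)).biUnion fun j =>
        (cellIndices d J).filter fun q => (fun k => q k / 2 ^ (J - j)) ∈ B j := by
    intro q hq
    simp only [Finset.mem_filter, not_forall, not_not, Finset.mem_biUnion, Finset.mem_range] at hq ⊢
    obtain ⟨hq, j, hj, h⟩ := hq
    exact ⟨j, by omega, hq, h⟩
  have h1 : (((cellIndices d J).filter (fun q =>
      ¬ ∀ j ≤ J, (fun k => q k / 2 ^ (J - j)) ∉ B j)).card : ℝ) ≤ ((2 : ℝ) ^ J) ^ d / 2 := by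
    calc _ ≤ ∑ j ∈ Finset.range (J + 1), (((2 : ℝ) ^ (J - j)) ^ d * (B j).card) := by
          refine le_trans (Nat.cast_le.2 ((Finset.card_le_card hsub).trans
            (Finset.card_biUnion_le.trans
              (Finset.sum_le_sum fun j _ => card_filter_ancestor_mem_le (B j))))) ?_
          push_cast
          rfl
      _ ≤ ∑ j ∈ Finset.range (J + 1), ((2 : ℝ) ^ J) ^ d * ε j := by
          refine Finset.sum_le_sum fun j hj => ?_
          have hj : j ≤ J := Nat.lt_succ_iff.1 (Finset.mem_range.1 hj)
          calc _ ≤ ((2 : ℝ) ^ (J - j)) ^ d * (ε j * (2 ^ j) ^ d) := by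
                gcongr
                exact hB j hj
            _ = (((2 : ℝ) ^ (J - j)) * 2 ^ j) ^ d * ε j := by
                rw [mul_pow]
                ring
            _ = _ := by rw [← pow_add, Nat.sub_add_cancel hj]
      _ ≤ ((2 : ℝ) ^ J) ^ d * (1 / 2) := by
          rw [← Finset.mul_sum]
          gcongr
      _ = _ := by ring
  have h2 := Finset.card_filter_add_card_filter_not (s := cellIndices d J)
    (fun q => ∀ j ≤ J, (fun k => q k / 2 ^ (J - j)) ∉ B j)
  rw [card_cellIndices] at h2
  have h3 := congrArg (Nat.cast (R := ℝ)) h2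
  push_cast at h3
  linarith

/-! ### Summing tolerances and error probabilities -/

/-- The tolerated proportion of bad cells in level `j`, for which the Chernoff bound is
`exp (-c (1 + j) n ^ α)`. -/
noncomputable def tolerance (d : ℕ) (K α c n : ℝ) (j : ℕ) : ℝ :=
  (2 * Real.exp (-(K * (n / (2 ^ j) ^ d) ^ α / 2)) + 2 * (c * (1 + j) * n ^ α / (2 ^ j) ^ d)) /
    (K * (n / (2 ^ j) ^ d) ^ α)

lemma two_mul_exp_neg_half_div_le {μ : ℝ} (hμ : 0 < μ) :
    2 * Real.exp (-(μ / 2)) / μ ≤ 4 / μ ^ 2 := by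
  have h := Real.add_one_le_exp (μ / 2)
  rw [Real.exp_neg, div_le_div_iff₀ hμ (by positivity)]
  have h1 : (Real.exp (μ / 2))⁻¹ * μ ≤ 2 := by
    rw [inv_mul_le_iff₀ (Real.exp_pos _)]
    linarith
  nlinarith

lemma two_pow_le_two_pow_pow {d : ℕ} (hd : 1 ≤ d) (i : ℕ) : (2 : ℝ) ^ i ≤ (2 ^ i) ^ d :=
  le_self_pow₀ (one_le_pow₀ one_le_two) (by omega)

/-- The exponential part of the tolerance is at most 4/μ², with μ here the mean number of heavy
vertices; it decays geometrically from level J upwards to the root, and a large M makes it small.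
The other part is c times a series converging in j, and a small c handles it. -/
lemma exists_sum_tolerance_le {d : ℕ} (hd : 1 ≤ d) {K α : ℝ} (hK : 0 < K) (hα : 0 < α)
    (hα' : α ≤ 1 / 2) (M₀ : ℝ) : ∃ M c : ℝ, 0 < M ∧ M₀ ≤ M ∧ 0 < c ∧ c ≤ 1 ∧
      ∀ (n : ℝ) (J : ℕ), M * (2 ^ J) ^ d ≤ n →
        ∑ j ∈ Finset.range (J + 1), tolerance d K α c n j ≤ 1 / 2 := by
  set ρ : ℝ := 2 ^ (-(2 * α)) with hρ
  have hρ0 : 0 < ρ := by positivity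
  have hρ1 : ρ < 1 := Real.rpow_lt_one_of_one_lt_of_neg one_lt_two (by linarith)
  have hρ' : 0 < 1 - ρ := by linarith
  set σ : ℝ := 2 ^ (-(1 / 2) : ℝ) with hσ
  have hσ0 : 0 < σ := by positivity
  have hσ1 : σ < 1 := Real.rpow_lt_one_of_one_lt_of_neg one_lt_two (by norm_num)
  have hsum : Summable fun j : ℕ => (1 + (j : ℝ)) * σ ^ j := by
    have h1 := summable_pow_mul_geometric_of_norm_lt_one 1
      (show ‖σ‖ < 1 by rwa [Real.norm_of_nonneg hσ0.le])
    simpa [add_mul] using (summable_geometric_of_lt_one hσ0.le hσ1).add h1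
  set S : ℝ := ∑' j : ℕ, (1 + (j : ℝ)) * σ ^ j with hS
  have hS0 : 0 ≤ S := tsum_nonneg fun j => by positivity
  -- With M^(2α) ≥ A the first series is at most 1/4; the choice of `c` below does the same for the
  -- second.
  set A : ℝ := 16 / (K ^ 2 * (1 - ρ)) with hA
  have hA0 : 0 < A := by positivity
  set M : ℝ := max M₀ (A ^ (1 / (2 * α))) with hM
  have hM0 : 0 < M := lt_max_of_lt_right (by positivity)
  have hMA : A ≤ (M ^ α) ^ 2 := by
    calc A = (A ^ (1 / (2 * α))) ^ (2 * α) := by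
          rw [← Real.rpow_mul hA0.le, one_div, inv_mul_cancel₀ (by positivity), Real.rpow_one]
      _ ≤ M ^ (2 * α) := Real.rpow_le_rpow (by positivity) (le_max_right _ _) (by positivity)
      _ = _ := by rw [mul_comm, Real.rpow_mul hM0.le, Real.rpow_two]
  set c : ℝ := min 1 (K / (8 * (S + 1))) with hc
  have hc0 : 0 < c := lt_min one_pos (by positivity)
  refine ⟨M, c, hM0, le_max_left _ _, hc0, min_le_left _ _, fun n J hn => ?_⟩
  have hn0 : 0 < n := lt_of_lt_of_le (by positivity) hn
  have hterm : ∀ j ∈ Finset.range (J + 1), tolerance d K α c n j ≤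
      4 / (K ^ 2 * (M ^ α) ^ 2) * ρ ^ (J - j) + 2 * c / K * ((1 + (j : ℝ)) * σ ^ j) := by
    intro j hj
    have hj : j ≤ J := Nat.lt_succ_iff.1 (Finset.mem_range.1 hj)
    have hN : (0 : ℝ) < (2 ^ j) ^ d := by positivity
    have hμ : 0 < K * (n / (2 ^ j) ^ d) ^ α := by positivity
    rw [tolerance, add_div]
    refine add_le_add ((two_mul_exp_neg_half_div_le hμ).trans ?_) ?_
    · have h1 : K * (M ^ α * (2 ^ (J - j)) ^ α) ≤ K * (n / (2 ^ j) ^ d) ^ α := by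
        rw [← Real.mul_rpow hM0.le (by positivity)]
        gcongr
        rw [le_div_iff₀ hN]
        calc M * 2 ^ (J - j) * (2 ^ j) ^ d ≤ M * (2 ^ (J - j)) ^ d * (2 ^ j) ^ d := by
              gcongr
              exact two_pow_le_two_pow_pow hd _
          _ = M * (2 ^ J) ^ d := by
              rw [mul_assoc, ← mul_pow, ← pow_add, Nat.sub_add_cancel hj]
          _ ≤ n := hn
      have h2 : ρ ^ (J - j) = (((2 : ℝ) ^ (J - j)) ^ α)⁻¹ ^ 2 := by
        rw [← Real.rpow_pow_comm two_pos.le, hρ, Real.rpow_neg two_pos.le, mul_comm 2 α,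
          Real.rpow_mul two_pos.le, Real.rpow_two, inv_pow, inv_pow]
        ring
      calc 4 / (K * (n / (2 ^ j) ^ d) ^ α) ^ 2 ≤ 4 / (K * (M ^ α * (2 ^ (J - j)) ^ α)) ^ 2 := by
            gcongr
        _ = _ := by
            rw [h2]
            field_simp
    -- With N = 2^(jd) ≥ 2^j, the bound α ≤ 1/2 gives N^(α - 1) ≤ N^(-1/2) ≤ σ^j.
    · have h3 : ((2 : ℝ) ^ j) ^ d * σ ^ j ≥ (((2 : ℝ) ^ j) ^ d) ^ α := by
        have h4 : ((2 : ℝ) ^ j) ≤ (2 ^ j) ^ d := two_pow_le_two_pow_pow hd _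
        have h5 : σ ^ j = ((2 : ℝ) ^ j) ^ (-(1 / 2) : ℝ) := by
          rw [hσ, ← Real.rpow_natCast, ← Real.rpow_natCast, ← Real.rpow_mul two_pos.le,
            ← Real.rpow_mul two_pos.le, mul_comm]
        calc (((2 : ℝ) ^ j) ^ d) ^ α ≤ (((2 : ℝ) ^ j) ^ d) ^ (1 + -(1 / 2) : ℝ) := by
              refine Real.rpow_le_rpow_of_exponent_le ?_ (by linarith)
              exact one_le_pow₀ (one_le_pow₀ one_le_two)
          _ = ((2 : ℝ) ^ j) ^ d * (((2 : ℝ) ^ j) ^ d) ^ (-(1 / 2) : ℝ) := by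
              rw [Real.rpow_add hN, Real.rpow_one]
          _ ≤ _ := by
              rw [h5]
              gcongr 1
              exact Real.rpow_le_rpow_of_nonpos (by positivity) h4 (by norm_num)
      rw [Real.div_rpow hn0.le hN.le]
      have e : 2 * (c * (1 + (j : ℝ)) * n ^ α / (2 ^ j) ^ d) /
          (K * (n ^ α / ((2 ^ j) ^ d) ^ α)) =
            2 * c / K * (1 + (j : ℝ)) * ((((2 : ℝ) ^ j) ^ d) ^ α / (2 ^ j) ^ d) := by
        have : 0 < n ^ α := by positivity
        field_simp
      rw [e, ← mul_assoc]
      gcongr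
      rw [div_le_iff₀ hN]
      linarith
  refine (Finset.sum_le_sum hterm).trans ?_
  rw [Finset.sum_add_distrib, ← Finset.mul_sum, ← Finset.mul_sum]
  have h1 : ∑ j ∈ Finset.range (J + 1), ρ ^ (J - j) ≤ (1 - ρ)⁻¹ := by
    have h := Finset.sum_range_reflect (fun j => ρ ^ j) (J + 1)
    simp only [Nat.add_sub_cancel] at h
    rw [h, ← tsum_geometric_of_lt_one hρ0.le hρ1]
    exact (summable_geometric_of_lt_one hρ0.le hρ1).sum_le_tsum _ fun i _ => by positivity
  have h2 : ∑ j ∈ Finset.range (J + 1), (1 + (j : ℝ)) * σ ^ j ≤ S :=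
    hsum.sum_le_tsum _ fun i _ => by positivity
  have h3 : 4 / (K ^ 2 * (M ^ α) ^ 2) * ∑ j ∈ Finset.range (J + 1), ρ ^ (J - j) ≤ 1 / 4 := by
    calc _ ≤ 4 / (K ^ 2 * A) * (1 - ρ)⁻¹ := by gcongr
      _ = 1 / 4 := by
          rw [hA]
          field_simp
          norm_num
  have h4 : 2 * c / K * ∑ j ∈ Finset.range (J + 1), (1 + (j : ℝ)) * σ ^ j ≤ 1 / 4 := by
    calc _ ≤ 2 * (K / (8 * (S + 1))) / K * (S + 1) := by
          gcongr
          · exact min_le_right _ _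
          · linarith
      _ = 1 / 4 := by
          field_simp
          norm_num
  linarith

/-- With z = e^(-y/2) ≤ 2/5 the left side is at most (9/4)z² ≤ z; halving the exponent absorbs the
union bound over all levels. -/
lemma sum_exp_neg_le {y : ℝ} (hy : 3 ≤ y) (J : ℕ) :
    Real.exp (-y) + ∑ j ∈ Finset.range (J + 1), Real.exp (-(y * (1 + j))) ≤
      Real.exp (-(y / 2)) := by
  set z := Real.exp (-(y / 2)) with hz
  have hz0 : 0 < z := Real.exp_pos _
  have hz1 : z ≤ 2 / 5 := by
    have h := Real.add_one_le_exp (y / 2)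
    rw [hz, Real.exp_neg, inv_le_comm₀ (Real.exp_pos _) (by norm_num)]
    linarith
  have e : Real.exp (-y) = z ^ 2 := by
    rw [hz, ← Real.exp_nat_mul]
    congr 1
    push_cast
    ring
  have e2 (j : ℕ) : Real.exp (-(y * (1 + j))) = z ^ 2 * (z ^ 2) ^ j := by
    rw [← pow_succ', ← e, ← Real.exp_nat_mul]
    congr 1
    push_cast
    ring
  simp_rw [e2, e, ← Finset.mul_sum]
  have hq : z ^ 2 < 1 := by nlinarith
  have hg : ∑ j ∈ Finset.range (J + 1), (z ^ 2) ^ j ≤ (1 - z ^ 2)⁻¹ := by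
    rw [← tsum_geometric_of_lt_one (by positivity) hq]
    exact (summable_geometric_of_lt_one (by positivity) hq).sum_le_tsum _ fun i _ => by positivity
  have h5 : (1 - z ^ 2)⁻¹ ≤ 5 / 4 := by
    rw [inv_le_comm₀ (by linarith) (by norm_num)]
    nlinarith
  have h6 : z ^ 2 * ∑ j ∈ Finset.range (J + 1), (z ^ 2) ^ j ≤ z ^ 2 * (5 / 4) := by
    gcongr
    exact hg.trans h5
  nlinarith

/-! ### Void cells of the random graph -/

/-- The event that the cell of level `j` with index `q` has no heavy vertex. -/
def cellVoid {d : ℕ} (lam : ℝ) (n : ℝ≥0) (j : ℕ) (q : Fin d → ℕ) : Set (MarkedSample d) :=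
  {ω | ∀ v, ω.2 v ∉ dyadicCell j q ×ˢ Set.Ici (heavyWeight d lam n j)}

open scoped Classical in
/-- The indices of the cells of level `j` without heavy vertices. -/
noncomputable def voidCells {d : ℕ} (lam : ℝ) (n : ℝ≥0) (ω : MarkedSample d) (j : ℕ) :
    Finset (Fin d → ℕ) :=
  (cellIndices d j).filter fun q => ω ∈ cellVoid lam n j q

lemma mem_voidCells {d : ℕ} {lam : ℝ} {n : ℝ≥0} {ω : MarkedSample d} {j : ℕ} {q : Fin d → ℕ} :
    q ∈ voidCells lam n ω j ↔ q ∈ cellIndices d j ∧ ω ∈ cellVoid lam n j q := by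
  simp [voidCells]

lemma mul_heavyWeight_rpow_neg {d : ℕ} {lam τ : ℝ} (hlam : 0 < lam) {n : ℝ≥0} (hn : 0 < n)
    (j : ℕ) : (n : ℝ) / (2 ^ j) ^ d * heavyWeight d lam n j ^ (-(τ - 1)) =
      ((2 : ℝ) ^ d / lam) ^ (-(τ - 1) / 2) * ((n : ℝ) / (2 ^ j) ^ d) ^ ((3 - τ) / 2) := by
  have hn' : (0 : ℝ) < n := hn
  have hy : 0 < (n : ℝ) / (2 ^ j) ^ d := by positivity
  rw [heavyWeight, Real.sqrt_eq_rpow, ← Real.rpow_mul (by positivity), mul_div_right_comm,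
    Real.mul_rpow (by positivity) hy.le, show (3 - τ) / 2 = 1 + 1 / 2 * -(τ - 1) by ring,
    Real.rpow_add hy, Real.rpow_one, show -(τ - 1) / 2 = 1 / 2 * -(τ - 1) by ring]
  ring

/-- Chernoff with p = e^(-μ) and s = μ/2, where μ is the mean number of heavy vertices; `tolerance`
solves for the resulting exponent. The condition on `lam` makes the heavy threshold at least 1,
where the Pareto tail is a pure power. -/
lemma markedPoissonLaw_real_tolerance_mul_le_card_voidCells_le {d : ℕ} {τ lam : ℝ} (hτ : 1 < τ)
    (hlam : 0 < lam) {n : ℝ≥0} (hn : 0 < n) {j : ℕ} (hW : lam ≤ n / (2 ^ j) ^ d) (c : ℝ) :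
    (markedPoissonLaw d τ n).real {ω | tolerance d (((2 : ℝ) ^ d / lam) ^ (-(τ - 1) / 2))
        ((3 - τ) / 2) c n j * (2 ^ j) ^ d ≤ ((voidCells lam n ω j).card : ℝ)} ≤
      Real.exp (-(c * (n : ℝ) ^ ((3 - τ) / 2) * (1 + j))) := by
  have := isProbabilityMeasure_markedPoissonLaw d hτ n
  have hn' : (0 : ℝ) < n := hn
  have h1 : 1 ≤ heavyWeight d lam n j := by
    refine Real.one_le_sqrt.2 ((one_le_div hlam).2 (hW.trans ?_))
    exact le_mul_of_one_le_left (by positivity) (one_le_pow₀ one_le_two)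
  set K := ((2 : ℝ) ^ d / lam) ^ (-(τ - 1) / 2) with hK
  set μ := K * ((n : ℝ) / (2 ^ j) ^ d) ^ ((3 - τ) / 2) with hμ
  have hμ0 : 0 < μ := by positivity
  refine (measureReal_le_card_filter_le _ (cellIndices d j) (cellVoid lam n j)
    (fun q _ => measurableSet_forall_notMem ((measurableSet_dyadicCell j q).prod
      measurableSet_Ici)) (Real.exp_nonneg (-μ)) (fun S hS => ?_)
    (show 0 ≤ μ / 2 by positivity) _).trans_eq ?_
  · rw [hμ, hK, ← mul_heavyWeight_rpow_neg hlam hn]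
    exact (markedPoissonLaw_real_iInter_void d hτ n h1
      fun q hq => mem_cellIndices.1 (hS hq)).le
  · rw [card_cellIndices, ← Real.exp_add, tolerance, ← hμ, show -μ + μ / 2 = -(μ / 2) by ring]
    push_cast
    congr 1
    field_simp
    ring

/-- A sample with few void cells has a large component. -/
lemma exists_component_of_card_voidCells_le {d : ℕ} (hd : 1 ≤ d) {lam : ℝ} (hlam : 0 < lam)
    {n : ℝ≥0} (hn : 0 < n) {ω : MarkedSample d} {J : ℕ} {ε : ℕ → ℝ}
    (hB : ∀ j ≤ J, ((voidCells lam n ω j).card : ℝ) ≤ ε j * (2 ^ j) ^ d)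
    (hε : ∑ j ∈ Finset.range (J + 1), ε j ≤ 1 / 2) :
    ∃ C : (torusGIRG lam n ω).ConnectedComponent,
      ((2 : ℝ) ^ J) ^ d / 2 ≤ (C.supp.ncard : ℝ) := by
  have h := half_le_card_filter_ancestor_notMem (voidCells lam n ω) ε hB hε
  set L := (cellIndices d J).filter fun q =>
    ∀ j ≤ J, (fun k => q k / 2 ^ (J - j)) ∉ voidCells lam n ω j with hL
  have hL0 : L.Nonempty := by
    rw [← Finset.card_pos, ← Nat.cast_pos (α := ℝ)]
    exact lt_of_lt_of_le (by positivity) h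
  obtain ⟨C, hC⟩ := exists_component_of_heavy hd hlam hn (ω := ω) hL0
    (fun q hq => mem_cellIndices.1 (Finset.mem_filter.1 hq).1) (fun q hq j hj => by
      have h1 := (Finset.mem_filter.1 hq).2 j hj
      have h2 : (fun k => q k / 2 ^ (J - j)) ∈ cellIndices d j := mem_cellIndices.2 fun i => by
        have h3 := mem_cellIndices.1 (Finset.mem_filter.1 hq).1 i
        rw [Nat.div_lt_iff_lt_mul (by positivity), ← pow_add]
        rwa [show j + (J - j) = J by omega]
      by_contra hno
      exact h1 (mem_voidCells.2 ⟨h2, fun v hv => hno ⟨v, hv⟩⟩))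
  exact ⟨C, h.trans (by exact_mod_cast hC)⟩

/-! ### Choice of the last level and union bound -/

theorem mainTheorem4 (d : ℕ) (hd : 1 ≤ d) (τ lam : ℝ) (hτ : τ ∈ Set.Ioo (2 : ℝ) 3)
    (hlam : 0 < lam) :
    ∃ a b c : ℝ, 0 < a ∧ 0 < b ∧ 0 < c ∧ ∃ n₀ : ℝ≥0, ∀ n : ℝ≥0, n₀ ≤ n →
      1 - Real.exp (-(c * (n : ℝ) ^ ((3 - τ) / 2))) ≤
        (markedPoissonLaw d τ n).real
          {ω | ∃ C : (torusGIRG lam n ω).ConnectedComponent,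
            a * (n : ℝ) ≤ (C.supp.ncard : ℝ) ∧ (C.supp.ncard : ℝ) ≤ b * (n : ℝ)} := by
  obtain ⟨hτ2, hτ3⟩ := hτ
  have hτ1 : 1 < τ := by linarith
  set α := (3 - τ) / 2 with hα
  have hα0 : 0 < α := by rw [hα]; linarith
  have hα1 : α ≤ 1 / 2 := by rw [hα]; linarith
  set K := ((2 : ℝ) ^ d / lam) ^ (-(τ - 1) / 2) with hK
  obtain ⟨M, c, hM0, hM, hc0, hc1, hsum⟩ :=
    exists_sum_tolerance_le hd (show 0 < K by positivity) hα0 hα1 lam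
  refine ⟨1 / (2 * 2 ^ d * M), 4, c / 2, by positivity, by norm_num, by positivity,
    max 1 (max (Real.toNNReal M) (Real.toNNReal ((3 / c) ^ (1 / α)))), fun n hn => ?_⟩
  have := isProbabilityMeasure_markedPoissonLaw d hτ1 n
  obtain ⟨hn1, hn2, hn3⟩ : 1 ≤ n ∧ M ≤ n ∧ (3 / c) ^ (1 / α) ≤ n := by
    simpa [Real.toNNReal_le_iff_le_coe] using hn
  have hn0 : 0 < n := one_pos.trans_le hn1
  have hn1' : (1 : ℝ) ≤ n := hn1
  have hn0' : (0 : ℝ) < n := hn0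
  have hcn : 3 ≤ c * (n : ℝ) ^ α := by
    have h := Real.rpow_le_rpow (by positivity) hn3 hα0.le
    rw [← Real.rpow_mul (by positivity), one_div, inv_mul_cancel₀ hα0.ne', Real.rpow_one,
      div_le_iff₀ hc0] at h
    linarith
  -- J is the last level with M 2^(Jd) ≤ n; its maximality gives n < 2^d M 2^(Jd), hence the
  -- constant 1/(2·2^d·M).
  obtain ⟨J, hJ1, hJ2⟩ := exists_nat_pow_near ((one_le_div hM0).2 hn2)
    (one_lt_pow₀ (one_lt_two (α := ℝ)) (by omega : d ≠ 0))
  rw [pow_right_comm, le_div_iff₀ hM0] at hJ1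
  rw [pow_succ, pow_right_comm, div_lt_iff₀ hM0] at hJ2
  have hε := hsum n J (by linarith)
  set good := {ω : MarkedSample d | ∃ C : (torusGIRG lam n ω).ConnectedComponent,
    1 / (2 * 2 ^ d * M) * (n : ℝ) ≤ (C.supp.ncard : ℝ) ∧ (C.supp.ncard : ℝ) ≤ 4 * (n : ℝ)}
    with hgood
  set F : ℕ → Set (MarkedSample d) := fun j =>
    {ω | tolerance d K α c n j * (2 ^ j) ^ d ≤ ((voidCells lam n ω j).card : ℝ)} with hF
  have hcover : Set.univ ⊆ good ∪ ({ω | 4 * (n : ℝ) < ω.1} ∪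
      ⋃ j ∈ Finset.range (J + 1), F j) := by
    intro ω _
    by_contra hω
    simp only [Set.mem_union, Set.mem_iUnion, not_or, not_exists, hF, Set.mem_ofPred_eq,
      not_lt, not_le, Finset.mem_range] at hω
    obtain ⟨hω1, hω2, hω3⟩ := hω
    obtain ⟨C, hC⟩ := exists_component_of_card_voidCells_le hd hlam hn0
      (fun j hj => (hω3 j (by omega)).le) hε
    refine hω1 ⟨C, le_trans ?_ hC, le_trans ?_ hω2⟩
    · rw [one_div, inv_mul_le_iff₀ (by positivity)]
      nlinarith
    · have h := Set.ncard_le_card C.supp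
      rw [Nat.card_fin] at h
      exact_mod_cast h
  have hFle : ∀ j ∈ Finset.range (J + 1), (markedPoissonLaw d τ n).real (F j) ≤
      Real.exp (-(c * (n : ℝ) ^ α * (1 + j))) := fun j hj => by
    refine markedPoissonLaw_real_tolerance_mul_le_card_voidCells_le hτ1 hlam hn0 (hM.trans ?_) c
    rw [le_div_iff₀ (by positivity)]
    refine le_trans ?_ hJ1
    rw [mul_comm]
    gcongr
    · exact one_le_two
    · exact Nat.lt_succ_iff.1 (Finset.mem_range.1 hj)
  have hnexp : Real.exp (-(n : ℝ)) ≤ Real.exp (-(c * (n : ℝ) ^ α)) := by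
    have h := Real.rpow_le_rpow_of_exponent_le hn1' (show α ≤ 1 by linarith)
    rw [Real.rpow_one] at h
    have h0 : 0 ≤ (n : ℝ) ^ α := by positivity
    exact Real.exp_le_exp.2 (by nlinarith)
  have h1 : (1 : ℝ) ≤ (markedPoissonLaw d τ n).real good +
      (Real.exp (-(c * (n : ℝ) ^ α)) +
        ∑ j ∈ Finset.range (J + 1), Real.exp (-(c * (n : ℝ) ^ α * (1 + j)))) := by
    calc (1 : ℝ) = (markedPoissonLaw d τ n).real Set.univ := by simp
      _ ≤ _ := measureReal_mono hcover
      _ ≤ _ := measureReal_union_le _ _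
      _ ≤ _ := by
          gcongr
          refine (measureReal_union_le _ _).trans (add_le_add
            ((markedPoissonLaw_real_four_mul_lt_card_le d hτ1 n).trans hnexp) ?_)
          exact (measureReal_biUnion_finset_le _ _).trans (Finset.sum_le_sum hFle)
  have h2 := sum_exp_neg_le hcn J
  rw [show -(c / 2 * (n : ℝ) ^ α) = -(c * (n : ℝ) ^ α / 2) by ring]
  linarith
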